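/- **Conventions.** A groupoid $G$ is identified with its set of arrows, with inverse $g\mapsto g^*$ and partial product $(g,h)\mapsto gh$, defined exactly when $g^*g=hh^*$; $G^0=\{g^*g:g\in G\}$ is its set of units. $G$ is étale if it carries a topology for which the inverse and the product are continuous, the product is an open map on the space of composable pairs, and $G^0$ is open in $G$. ($G$ itself need not be Hausdorff.) For $O,N\subseteq G$ put $ON=\{gh: g\in O,\ h\in N,\ gh \text{ defined}\}$ and $O^*=\{g^*:g\in O\}$; $O$ is a bisection if $OO^*\cup O^*O\subseteq G^0$. Let $\mathbb D=\{z\in\mathbb C:|z|\le 1\}$ and $\mathbb T=\{z\in\mathbb C:|z|=1\}$. Let $S=\bigcup\{C_0(O,\mathbb D\setminus\{0\}) : O\subseteq G\text{ an open bisection}\}$: an element $a\in S$ is a continuous function $a:\mathrm{dom}(a)\to\mathbb D\setminus\{0\}$ on an open bisection $\mathrm{dom}(a)$ that vanishes at infinity, i.e. $\mathrm{dom}(a)\setminus a^{-1}[V]$ is compact for every open $V\ni 0$ in $\mathbb C$. When $G^0$ is Hausdorff, $S$ is a $*$-semigroup with $\mathrm{dom}(ab)=\mathrm{dom}(a)\mathrm{dom}(b)$,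 $(ab)(gh)=a(g)b(h)$ for $g\in\mathrm{dom}(a)$, $h\in\mathrm{dom}(b)$ with $gh$ defined, and $\mathrm{dom}(a^*)=\mathrm{dom}(a)^*$, $a^*(g)=\overline{a(g^*)}$. Write $a\precsim b$ if $\mathrm{dom}(a)\subseteq b^{-1}[\mathbb T]$, and for $T\subseteq S$ put $T^{\precsim}=\{a\in S:\exists t\in T\ (t\precsim a)\}$. Products and adjoints of subsets of $S$ are taken elementwise. A filter is a non-empty $U\subseteq S$ such that, for all $a,b\in S$: $a,b\in U$ if and only if there is $c\in U$ with $c\precsim a$ and $c\precsim b$. An ultrafilter is a filter that is maximal among the filters different from $S$. Let $\mathcal U(S)$ be the set of ultrafilters with the topology generated by the sets $\mathcal U_a=\{U\in\mathcal U(S):a\in U\}$, $a\in S$. **Proposition.** Let $G$ be a locally compact étale groupoid whose unit space $G^0$ is Hausdorff, and let $S$ be as above. Then $$g\mapsto S_g=\{a\in S: g\in\mathrm{int}(a^{-1}[\mathbb T])\}$$ is a homeomorphism from $G$ onto $\mathcal U(S)$. Moreover $\mathcal U(S)$ is a groupoid under the inverse $U\mapsto U^*$ and the product $(U,V)\mapsto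 (UV)^{\precsim}$, defined if and only if $(U^*U)^{\precsim}=(VV^*)^{\precsim}$, and the map $g\mapsto S_g$ is an isomorphism of groupoids: for all $g,h\in G$, $$S_{g^*}=(S_g)^*,$$ the product $gh$ is defined if and only if the product of $S_g$ and $S_h$ is defined in $\mathcal U(S)$, and, whenever $gh$ is defined, $$S_{gh}=(S_gS_h)^{\precsim}=\{a\in S: bc\precsim a\text{ for some } b\in S_g,\ c\in S_h\}.$$ -/

import Mathlib

open scoped Pointwise

namespace Weyl

/-- A groupoid, presented by its set `G` of arrows: a total involution `a ↦ a⋆` and a partial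
product, where `pmul a b = some c` means that `ab` is defined and equal to `c`, and
`pmul a b = none` that `ab` is not defined.  Equations between partial products mean that the left
side is defined if and only if the right side is, in which case they agree.  A unit is a `u` such
that `ua = a` whenever `ua` is defined. -/
class ArrowGroupoid (G : Type*) extends Star G where
  /-- the partial product -/
  pmul : G → G → Option G
  star_star_arrow : ∀ a : G, star (star a) = a
  pmul_assoc : ∀ a b c : G,
    ((pmul b c).bind fun x => pmul a x) = ((pmul a b).bind fun x => pmul x c)
  star_pmul : ∀ a b : G, (pmul a b).map star = pmul (star b) (star a)
  pmul_star_isSome : ∀ a : G, (pmul a (star a)).isSome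
  /-- every arrow `b` has a range unit `r`, such that `ab` is defined iff `ar` is defined -/
  exists_range : ∀ b : G, ∃ r : G, (∀ a x, pmul r a = some x → x = a) ∧
    ∀ a, (pmul a b).isSome ↔ (pmul a r).isSome
  /-- every arrow is a unitary: `aa⋆` and `a⋆a` are units -/
  unitary_left : ∀ a u : G, pmul a (star a) = some u → ∀ b x, pmul u b = some x → x = b
  unitary_right : ∀ a u : G, pmul (star a) a = some u → ∀ b x, pmul u b = some x → x = b

open ArrowGroupoid

section Algebra

/-- The unit space `G⁰`: all `u` with `ua = a` whenever `ua` is defined. -/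
def units (G : Type*) [ArrowGroupoid G] : Set G := {u | ∀ a x, pmul u a = some x → x = a}

variable {G : Type*} [ArrowGroupoid G]

/-- The set product `ON = {gh : g ∈ O, h ∈ N, gh is defined}`. -/
def setMul (O N : Set G) : Set G := {k | ∃ g ∈ O, ∃ h ∈ N, pmul g h = some k}

/-- A bisection: `OO⋆ ∪ O⋆O ⊆ G⁰`. -/
def IsBisection (O : Set G) : Prop :=
  setMul O (star '' O) ∪ setMul (star '' O) O ⊆ units G

theorem assoc_left {a b c x y : G} (h1 : pmul a b = some x) (h2 : pmul x c = some y) :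
    ∃ z, pmul b c = some z ∧ pmul a z = some y := by
  have h := pmul_assoc a b c
  rw [h1, Option.bind_some, h2] at h
  exact Option.bind_eq_some_iff.1 h

theorem assoc_right {a b c z y : G} (h1 : pmul b c = some z) (h2 : pmul a z = some y) :
    ∃ x, pmul a b = some x ∧ pmul x c = some y := by
  have h := pmul_assoc a b c
  rw [h1, Option.bind_some, h2] at h
  exact Option.bind_eq_some_iff.1 h.symm

theorem star_mul_some {a b x : G} (h : pmul a b = some x) :
    pmul (star b) (star a) = some (star x) := by
  rw [← star_pmul, h, Option.map_some]

theorem star_arrow_injective {a b : G} (h : star a = star b) : a = b := by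
  rw [← star_star_arrow a, h, star_star_arrow]

theorem exists_mul_star (a : G) : ∃ u, pmul a (star a) = some u :=
  Option.isSome_iff_exists.1 (pmul_star_isSome a)

theorem star_unit {u : G} (hu : u ∈ units G) : star u = u := by
  obtain ⟨x, hx⟩ := exists_mul_star u
  have h1 := hu _ _ hx
  have h2 := star_mul_some hx
  rw [star_star_arrow, hx] at h2
  have h3 : x = star x := Option.some.inj h2
  rw [h1, star_star_arrow] at h3
  exact h3

theorem mul_unit {a u x : G} (hu : u ∈ units G) (h : pmul a u = some x) : x = a := by
  have h1 := star_mul_some h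
  rw [star_unit hu] at h1
  exact star_arrow_injective (hu _ _ h1)

theorem unit_mul_self {u : G} (hu : u ∈ units G) : pmul u u = some u := by
  obtain ⟨x, hx⟩ := exists_mul_star u
  rw [star_unit hu] at hx
  rw [hx, hu _ _ hx]

theorem exists_rng (b : G) : ∃ r ∈ units G, pmul b (star b) = some r ∧ pmul r b = some b ∧
    ∀ a, (pmul a b).isSome ↔ (pmul a r).isSome := by
  obtain ⟨r, hr, hD⟩ := exists_range b
  replace hr : r ∈ units G := hr
  obtain ⟨u, hu⟩ := exists_mul_star b
  have huu : u ∈ units G := unitary_left b u hu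
  obtain ⟨x, hx⟩ := Option.isSome_iff_exists.1
    ((hD r).2 (Option.isSome_iff_exists.2 ⟨r, unit_mul_self hr⟩))
  rw [hr _ _ hx] at hx
  obtain ⟨z, hz1, hz2⟩ := assoc_left hx hu
  rw [hu] at hz1
  obtain rfl := Option.some.inj hz1
  have hur : u = r := mul_unit huu hz2
  subst hur
  exact ⟨u, huu, hu, hx, hD⟩

/-- The range `r(b) = bb⋆`. -/
noncomputable def rng (b : G) : G := (exists_rng b).choose

/-- The source `s(b) = r(b⋆) = b⋆b`. -/
noncomputable def src (b : G) : G := rng (star b)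

theorem rng_mem (b : G) : rng b ∈ units G := (exists_rng b).choose_spec.1

theorem mul_star_arrow (b : G) : pmul b (star b) = some (rng b) :=
  (exists_rng b).choose_spec.2.1

theorem rng_mul (b : G) : pmul (rng b) b = some b := (exists_rng b).choose_spec.2.2.1

theorem defined_iff (a b : G) : (pmul a b).isSome ↔ (pmul a (rng b)).isSome :=
  (exists_rng b).choose_spec.2.2.2 a

theorem star_mul_arrow (b : G) : pmul (star b) b = some (src b) := by
  have := mul_star_arrow (star b)
  rwa [star_star_arrow] at this

theorem mul_src (b : G) : pmul b (src b) = some b := by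
  have := star_mul_some (rng_mul (star b))
  rwa [star_star_arrow, star_unit (rng_mem _)] at this

theorem src_mem (b : G) : src b ∈ units G := rng_mem _

theorem src_unit {u : G} (hu : u ∈ units G) : src u = u := by
  have := star_mul_arrow u
  rw [star_unit hu, unit_mul_self hu] at this
  exact (Option.some.inj this).symm

theorem src_eq_rng {a b x : G} (h : pmul a b = some x) : src a = rng b := by
  obtain ⟨z, hz⟩ := Option.isSome_iff_exists.1
    ((defined_iff a b).1 (Option.isSome_iff_exists.2 ⟨x, h⟩))
  obtain ⟨w, hw, -⟩ := assoc_left (mul_src a) hz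
  rw [← mul_unit (rng_mem b) hw, src_mem a _ _ hw]

theorem exists_mul {a b : G} (h : src a = rng b) : ∃ x, pmul a b = some x :=
  Option.isSome_iff_exists.1 ((defined_iff a b).2
    (Option.isSome_iff_exists.2 ⟨a, by rw [← h]; exact mul_src a⟩))

theorem src_star (a : G) : src (star a) = rng a := by
  rw [src, star_star_arrow]

theorem rng_star (a : G) : rng (star a) = src a := rfl

theorem rng_of_mul {a b x : G} (h : pmul a b = some x) : rng x = rng a := by
  obtain ⟨w, hw1, hw2⟩ := assoc_left (rng_mul a) h
  rw [h] at hw1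
  obtain rfl := Option.some.inj hw1
  rw [← src_eq_rng hw2, src_unit (rng_mem a)]

theorem star_mul_cancel {a b x : G} (h : pmul a b = some x) : pmul (star a) x = some b := by
  obtain ⟨y, hy⟩ := exists_mul (a := star a) (b := x) (by rw [src_star, rng_of_mul h])
  obtain ⟨w, hw1, hw2⟩ := assoc_right h hy
  rw [star_mul_arrow] at hw1
  obtain rfl := Option.some.inj hw1
  rw [hy, src_mem a _ _ hw2]

theorem IsBisection.eq_of_rng {O : Set G} (hO : IsBisection O) {g h : G} (hg : g ∈ O)
    (hh : h ∈ O) (e : rng g = rng h) : g = h := by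
  obtain ⟨u, hu⟩ := exists_mul (a := star g) (b := h) (by rw [src_star, e])
  have huu : u ∈ units G := hO (Or.inr ⟨_, ⟨g, hg, rfl⟩, h, hh, hu⟩)
  have h1 := star_mul_cancel hu
  rw [star_star_arrow] at h1
  exact (mul_unit huu h1).symm

theorem IsBisection.eq_of_mul {O : Set G} (hO : IsBisection O) {g h g' h' k : G} (hg : g ∈ O)
    (hg' : g' ∈ O) (e : pmul g h = some k) (e' : pmul g' h' = some k) : g = g' ∧ h = h' := by
  obtain rfl := hO.eq_of_rng hg hg' (by rw [← rng_of_mul e, ← rng_of_mul e'])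
  refine ⟨rfl, ?_⟩
  have h1 := star_mul_cancel e
  rw [star_mul_cancel e'] at h1
  exact (Option.some.inj h1).symm

theorem IsBisection.star {O : Set G} (hO : IsBisection O) : IsBisection (Star.star '' O) := by
  have e : Star.star '' (Star.star '' O) = O := by
    rw [Set.image_image]; simp [star_star_arrow]
  rw [IsBisection, e, Set.union_comm]
  exact hO

theorem IsBisection.setMul_star {O N : Set G} (hO : IsBisection O) (hN : IsBisection N) :
    setMul (setMul O N) (Star.star '' setMul O N) ⊆ units G := by
  rintro u ⟨k, ⟨g, hg, h, hh, hk⟩, -, ⟨k', ⟨g', hg', h', hh', hk'⟩, rfl⟩, hu⟩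
  obtain ⟨w, hw1, hw2⟩ := assoc_left hk hu
  obtain ⟨v, hv1, hv2⟩ := assoc_right (star_mul_some hk') hw1
  have hv : v ∈ units G := hN (Or.inl ⟨h, hh, _, ⟨h', hh', rfl⟩, hv1⟩)
  have := hv _ _ hv2
  subst this
  exact hO (Or.inl ⟨g, hg, _, ⟨g', hg', rfl⟩, hw2⟩)

theorem star_setMul (O N : Set G) :
    Star.star '' setMul O N = setMul (Star.star '' N) (Star.star '' O) := by
  ext k
  constructor
  · rintro ⟨x, ⟨g, hg, h, hh, e⟩, rfl⟩
    exact ⟨_, ⟨h, hh, rfl⟩, _, ⟨g, hg, rfl⟩, star_mul_some e⟩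
  · rintro ⟨-, ⟨h, hh, rfl⟩, -, ⟨g, hg, rfl⟩, e⟩
    refine ⟨star k, ⟨g, hg, h, hh, ?_⟩, star_star_arrow k⟩
    have := star_mul_some e
    rwa [star_star_arrow, star_star_arrow] at this

theorem IsBisection.setMul {O N : Set G} (hO : IsBisection O) (hN : IsBisection N) :
    IsBisection (setMul O N) := by
  refine Set.union_subset (hO.setMul_star hN) ?_
  have e : Star.star '' (Star.star '' Weyl.setMul O N) = Weyl.setMul O N := by
    rw [Set.image_image]; simp [star_star_arrow]
  have := hN.star.setMul_star hO.star
  rwa [← star_setMul, e] at this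

theorem star_image_eq (O : Set G) : star '' O = star ⁻¹' O := by
  ext g
  constructor
  · rintro ⟨h, hh, rfl⟩
    rwa [Set.mem_preimage, star_star_arrow]
  · exact fun hg => ⟨_, hg, star_star_arrow g⟩

end Algebra

/-- The set of composable pairs. -/
abbrev Composable (G : Type*) [ArrowGroupoid G] : Type _ :=
  {p : G × G // (pmul p.1 p.2).isSome}

/-- The product as a total function on composable pairs. -/
def mulMap {G : Type*} [ArrowGroupoid G] (p : Composable G) : G :=
  (pmul p.1.1 p.1.2).get p.2

/-- An étale groupoid: a topological groupoid (the involution and the product are continuous)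
whose product is an open map and whose unit space is open. -/
class EtaleGroupoid (G : Type*) [TopologicalSpace G] [ArrowGroupoid G] : Prop where
  continuous_star : Continuous (star : G → G)
  continuous_mul : Continuous (mulMap : Composable G → G)
  isOpenMap_mul : IsOpenMap (mulMap : Composable G → G)
  isOpen_units : IsOpen (units G)

/-- The disjoint union `S = ⋃ C₀(O, 𝔻 ∖ {0})` over all open bisections `O ⊆ G`.  A function on `O`
with non-zero values is the same thing as a function `G → ℂ` with support `O`, and this is how an
element of `S` is stored: it is continuous on its domain `O`, which is the support, but need not be
continuous on `G`. -/
@[ext]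
structure C0Bisection (G : Type*) [TopologicalSpace G] [ArrowGroupoid G] where
  /-- the function, extended by `0` outside its domain -/
  toFun : G → ℂ
  isOpen_dom : IsOpen (Function.support toFun)
  isBisection_dom : IsBisection (Function.support toFun)
  continuousOn_dom : ContinuousOn toFun (Function.support toFun)
  norm_le_one : ∀ g, ‖toFun g‖ ≤ 1
  vanishes : ∀ V : Set ℂ, IsOpen V → 0 ∈ V → IsCompact (Function.support toFun \ toFun ⁻¹' V)

namespace C0Bisection

section Basic

variable {G : Type*} [TopologicalSpace G] [ArrowGroupoid G]

instance : CoeFun (C0Bisection G) (fun _ => G → ℂ) := ⟨toFun⟩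

/-- The domain `dom(a)`. -/
def dom (a : C0Bisection G) : Set G := Function.support a

/-- The set `a⁻¹[𝕋]` of points of `dom(a)` at which `a` has modulus one. -/
def preCircle (a : C0Bisection G) : Set G := {g ∈ a.dom | ‖a g‖ = 1}

/-- `a.StarDom b`: `b` `*`-dominates `a`, i.e. `dom(a) ⊆ b⁻¹[𝕋]`. -/
def StarDom (a b : C0Bisection G) : Prop := a.dom ⊆ b.preCircle

theorem mem_dom {a : C0Bisection G} {g : G} : g ∈ a.dom ↔ a g ≠ 0 := Iff.rfl

theorem ext_of_dom {a b : C0Bisection G} (h1 : ∀ g ∈ a.dom, b g = a g)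
    (h2 : ∀ g ∈ b.dom, a g = b g) : a = b := by
  ext g
  by_cases ha : g ∈ a.dom
  · exact (h1 g ha).symm
  · by_cases hb : g ∈ b.dom
    · exact h2 g hb
    · rw [mem_dom, not_not] at ha hb
      rw [ha, hb]

open Classical in
/-- The function underlying the product: `(ab)(gh) = a(g)b(h)` for `g ∈ dom(a)`, `h ∈ dom(b)` with
`gh` defined, and `0` off `dom(a)dom(b)`. -/
noncomputable def mulFun (a b : C0Bisection G) (k : G) : ℂ :=
  if h : ∃ p : G × G, p.1 ∈ a.dom ∧ p.2 ∈ b.dom ∧ pmul p.1 p.2 = some k then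
    a h.choose.1 * b h.choose.2
  else 0

theorem mulFun_apply (a b : C0Bisection G) {g h k : G} (hg : g ∈ a.dom) (hh : h ∈ b.dom)
    (e : pmul g h = some k) : mulFun a b k = a g * b h := by
  have H : ∃ p : G × G, p.1 ∈ a.dom ∧ p.2 ∈ b.dom ∧ pmul p.1 p.2 = some k :=
    ⟨(g, h), hg, hh, e⟩
  obtain ⟨h1, h2, h3⟩ := H.choose_spec
  obtain ⟨e1, e2⟩ := a.isBisection_dom.eq_of_mul hg h1 e h3
  rw [mulFun, dif_pos H, ← e1, ← e2]

theorem support_mulFun (a b : C0Bisection G) :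
    Function.support (mulFun a b) = setMul a.dom b.dom := by
  ext k
  constructor
  · intro hk
    by_contra hc
    refine hk (dif_neg ?_)
    rintro ⟨⟨g, h⟩, hg, hh, e⟩
    exact hc ⟨g, hg, h, hh, e⟩
  · rintro ⟨g, hg, h, hh, e⟩
    rw [Function.mem_support, mulFun_apply a b hg hh e]
    exact mul_ne_zero hg hh

theorem support_starFun (a : C0Bisection G) :
    (Function.support fun g => starRingEnd ℂ (a (star g))) = star '' a.dom := by
  ext g
  constructor
  · intro hg
    refine ⟨star g, ?_, star_star_arrow g⟩
    intro h0
    exact hg (by simp only [h0, map_zero])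
  · rintro ⟨h, hh, rfl⟩
    rw [Function.mem_support, star_star_arrow]
    exact (map_ne_zero _).2 hh

end Basic

variable {G : Type*} [TopologicalSpace G] [ArrowGroupoid G] [EtaleGroupoid G]

theorem isOpen_setMul {O N : Set G} (hO : IsOpen O) (hN : IsOpen N) : IsOpen (setMul O N) := by
  have e : setMul O N = mulMap '' (Subtype.val ⁻¹' (O ×ˢ N) : Set (Composable G)) := by
    ext k
    constructor
    · rintro ⟨g, hg, h, hh, e⟩
      exact ⟨⟨(g, h), by simp [e]⟩, ⟨hg, hh⟩, by simp [mulMap, e]⟩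
    · rintro ⟨⟨⟨g, h⟩, hp⟩, ⟨hg, hh⟩, rfl⟩
      exact ⟨g, hg, h, hh, by simp [mulMap]⟩
  rw [e]
  exact EtaleGroupoid.isOpenMap_mul _ ((hO.prod hN).preimage continuous_subtype_val)

theorem continuous_rng : Continuous (rng : G → G) := by
  have : (rng : G → G) = fun g => mulMap (⟨(g, star g), pmul_star_isSome g⟩ : Composable G) := by
    ext g; simp [mulMap, mul_star_arrow]
  rw [this]
  exact EtaleGroupoid.continuous_mul.comp
    ((continuous_id.prodMk EtaleGroupoid.continuous_star).subtype_mk _)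

theorem continuous_src : Continuous (src : G → G) :=
  continuous_rng.comp EtaleGroupoid.continuous_star

theorem continuousAt_mulFun (a b : C0Bisection G) {k : G} (hk : k ∈ setMul a.dom b.dom) :
    ContinuousAt (mulFun a b) k := by
  obtain ⟨g, hg, h, hh, e⟩ := hk
  have ha : ContinuousAt a g := a.continuousOn_dom.continuousAt (a.isOpen_dom.mem_nhds hg)
  have hb : ContinuousAt b h := b.continuousOn_dom.continuousAt (b.isOpen_dom.mem_nhds hh)
  have hab : ContinuousAt (fun p : G × G => a p.1 * b p.2) (g, h) :=
    (ContinuousAt.comp (x := (g, h)) (f := Prod.fst) ha continuousAt_fst).mul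
      (ContinuousAt.comp (x := (g, h)) (f := Prod.snd) hb continuousAt_snd)
  intro W hW
  rw [mulFun_apply a b hg hh e] at hW
  have h1 := hab hW
  rw [Filter.mem_map, nhds_prod_eq, Filter.mem_prod_iff] at h1
  obtain ⟨O, hO, N, hN, hON⟩ := h1
  obtain ⟨O', hO', hO'o, hgO'⟩ := mem_nhds_iff.1 (Filter.inter_mem hO (a.isOpen_dom.mem_nhds hg))
  obtain ⟨N', hN', hN'o, hhN'⟩ := mem_nhds_iff.1 (Filter.inter_mem hN (b.isOpen_dom.mem_nhds hh))
  rw [Filter.mem_map]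
  refine Filter.mem_of_superset
    ((isOpen_setMul hO'o hN'o).mem_nhds ⟨g, hgO', h, hhN', e⟩) ?_
  rintro x ⟨g', hg', h', hh', e'⟩
  rw [Set.mem_preimage, mulFun_apply a b (hO' hg').2 (hN' hh').2 e']
  exact hON (Set.mk_mem_prod (hO' hg').1 (hN' hh').1)

theorem isCompact_mulFun [T2Space (units G)] (a b : C0Bisection G) {V : Set ℂ} (hV : IsOpen V)
    (h0 : 0 ∈ V) : IsCompact (Function.support (mulFun a b) \ mulFun a b ⁻¹' V) := by
  obtain ⟨ε, hε, hεV⟩ := Metric.isOpen_iff.1 hV 0 h0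
  have hKa := a.vanishes _ (Metric.isOpen_ball (x := (0 : ℂ)) (ε := ε)) (Metric.mem_ball_self hε)
  have hKb := b.vanishes _ (Metric.isOpen_ball (x := (0 : ℂ)) (ε := ε)) (Metric.mem_ball_self hε)
  set Ka := Function.support a \ a ⁻¹' Metric.ball 0 ε with hKad
  set Kb := Function.support b \ b ⁻¹' Metric.ball 0 ε with hKbd
  have hK := hKa.prod hKb
  have : CompactSpace (Ka ×ˢ Kb : Set (G × G)) := isCompact_iff_compactSpace.1 hK
  have hab : Continuous fun p : (Ka ×ˢ Kb : Set (G × G)) => a p.1.1 * b p.1.2 := by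
    refine Continuous.mul ?_ ?_
    · exact a.continuousOn_dom.comp_continuous (continuous_fst.comp continuous_subtype_val)
        fun p => p.2.1.1
    · exact b.continuousOn_dom.comp_continuous (continuous_snd.comp continuous_subtype_val)
        fun p => p.2.2.1
  have hs : Continuous fun p : (Ka ×ˢ Kb : Set (G × G)) => (⟨src p.1.1, src_mem _⟩ : units G) :=
    (continuous_src.comp (continuous_fst.comp continuous_subtype_val)).subtype_mk _
  have hr : Continuous fun p : (Ka ×ˢ Kb : Set (G × G)) => (⟨rng p.1.2, rng_mem _⟩ : units G) :=
    (continuous_rng.comp (continuous_snd.comp continuous_subtype_val)).subtype_mk _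
  let C : Set (Ka ×ˢ Kb : Set (G × G)) :=
    {p | (⟨src p.1.1, src_mem _⟩ : units G) = ⟨rng p.1.2, rng_mem _⟩} ∩
      {p | a p.1.1 * b p.1.2 ∈ Vᶜ}
  have hC : IsClosed C := (isClosed_eq hs hr).inter (hV.isClosed_compl.preimage hab)
  have : CompactSpace C := isCompact_iff_compactSpace.1 hC.isCompact
  have hdef : ∀ p : C, (pmul p.1.1.1 p.1.1.2).isSome := fun p =>
    Option.isSome_iff_exists.2 (exists_mul (congrArg Subtype.val p.2.1))
  have hφ : Continuous fun p : C => mulMap (⟨p.1.1, hdef p⟩ : Composable G) :=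
    EtaleGroupoid.continuous_mul.comp
      ((continuous_subtype_val.comp continuous_subtype_val).subtype_mk _)
  convert isCompact_range hφ using 1
  ext k
  constructor
  · rintro ⟨hk, hkV⟩
    rw [support_mulFun] at hk
    obtain ⟨g, hg, h, hh, e⟩ := hk
    rw [Set.mem_preimage, mulFun_apply a b hg hh e] at hkV
    have hn : ε ≤ ‖a g * b h‖ := by
      by_contra hc
      exact hkV (hεV (by simpa using hc))
    rw [norm_mul] at hn
    have ha1 := a.norm_le_one g
    have hb1 := b.norm_le_one h
    have hga : ε ≤ ‖a g‖ := by nlinarith [norm_nonneg (a g), norm_nonneg (b h)]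
    have hhb : ε ≤ ‖b h‖ := by nlinarith [norm_nonneg (a g), norm_nonneg (b h)]
    refine ⟨⟨⟨(g, h), ⟨hg, by simpa using hga⟩, ⟨hh, by simpa using hhb⟩⟩, ?_, hkV⟩, ?_⟩
    · exact Subtype.ext (src_eq_rng e)
    · simp [mulMap, e]
  · rintro ⟨⟨⟨⟨g, h⟩, hg, hh⟩, hc, hV'⟩, rfl⟩
    have e : pmul g h = some (mulMap (⟨(g, h), Option.isSome_iff_exists.2
        (exists_mul (congrArg Subtype.val hc))⟩ : Composable G)) := by simp [mulMap]
    refine ⟨?_, ?_⟩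
    · rw [support_mulFun]
      exact ⟨g, hg.1, h, hh.1, e⟩
    · rw [Set.mem_preimage, mulFun_apply a b hg.1 hh.1 e]
      exact hV'

/-- The product of `S`: `(ab)(gh) = a(g)b(h)`, on the open bisection `dom(a)dom(b)`. -/
noncomputable instance [T2Space (units G)] : Mul (C0Bisection G) where
  mul a b :=
    { toFun := mulFun a b
      isOpen_dom := by
        rw [support_mulFun]; exact isOpen_setMul a.isOpen_dom b.isOpen_dom
      isBisection_dom := by
        rw [support_mulFun]; exact a.isBisection_dom.setMul b.isBisection_dom
      continuousOn_dom := fun k hk =>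
        (continuousAt_mulFun a b (by rwa [← support_mulFun])).continuousWithinAt
      norm_le_one := fun k => by
        by_cases hk : k ∈ setMul a.dom b.dom
        · obtain ⟨g, hg, h, hh, e⟩ := hk
          rw [mulFun_apply a b hg hh e, norm_mul]
          exact mul_le_one₀ (a.norm_le_one g) (norm_nonneg _) (b.norm_le_one h)
        · rw [← support_mulFun, Function.mem_support, not_not] at hk
          rw [hk, norm_zero]; exact zero_le_one
      vanishes := fun _ hV h0 => isCompact_mulFun a b hV h0 }

theorem mul_apply [T2Space (units G)] (a b : C0Bisection G) {g h k : G} (hg : g ∈ a.dom)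
    (hh : h ∈ b.dom) (e : pmul g h = some k) : (a * b) k = a g * b h :=
  mulFun_apply a b hg hh e

theorem dom_mul [T2Space (units G)] (a b : C0Bisection G) :
    (a * b).dom = setMul a.dom b.dom := support_mulFun a b

/-- The involution of `S`: `a⋆(g)` is the complex conjugate of `a(g⋆)`. -/
noncomputable instance : Star (C0Bisection G) where
  star a :=
    { toFun := fun g => starRingEnd ℂ (a (star g))
      isOpen_dom := by
        rw [support_starFun, star_image_eq]
        exact a.isOpen_dom.preimage EtaleGroupoid.continuous_star
      isBisection_dom := by
        rw [support_starFun]; exact a.isBisection_dom.star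
      continuousOn_dom := by
        rw [support_starFun, star_image_eq]
        exact Complex.continuous_conj.comp_continuousOn
          (a.continuousOn_dom.comp EtaleGroupoid.continuous_star.continuousOn fun _ h => h)
      norm_le_one := fun g => by
        rw [Complex.norm_conj]; exact a.norm_le_one _
      vanishes := fun V hV h0 => by
        have := (a.vanishes (starRingEnd ℂ ⁻¹' V) (hV.preimage Complex.continuous_conj)
          (by simpa using h0)).image EtaleGroupoid.continuous_star
        rw [support_starFun]
        rw [star_image_eq] at this ⊢
        exact this }

theorem star_apply (a : C0Bisection G) (g : G) : (star a) g = starRingEnd ℂ (a (star g)) := rfl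

theorem dom_star (a : C0Bisection G) : (star a).dom = star '' a.dom := support_starFun a

/-- `S` is a semigroup. -/
noncomputable instance [T2Space (units G)] : Semigroup (C0Bisection G) where
  mul_assoc a b c := by
    refine ext_of_dom ?_ ?_
    · intro k hk
      rw [dom_mul] at hk
      obtain ⟨x, hx, l, hl, e⟩ := hk
      rw [mul_apply _ _ hx hl e]
      rw [dom_mul] at hx
      obtain ⟨g, hg, h, hh, e'⟩ := hx
      obtain ⟨z, hz1, hz2⟩ := assoc_left e' e
      rw [mul_apply _ _ hg hh e',
        mul_apply a (b * c) hg (by rw [dom_mul]; exact ⟨h, hh, l, hl, hz1⟩) hz2,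
        mul_apply b c hh hl hz1, mul_assoc]
    · intro k hk
      rw [dom_mul] at hk
      obtain ⟨g, hg, z, hz, e⟩ := hk
      rw [mul_apply _ _ hg hz e]
      rw [dom_mul] at hz
      obtain ⟨h, hh, l, hl, e'⟩ := hz
      obtain ⟨x, hx1, hx2⟩ := assoc_right e' e
      rw [mul_apply _ _ hh hl e',
        mul_apply (a * b) c (by rw [dom_mul]; exact ⟨g, hg, h, hh, hx1⟩) hl hx2,
        mul_apply a b hg hh hx1, mul_assoc]

/-- `S` is a `*`-semigroup. -/
noncomputable instance [T2Space (units G)] : StarMul (C0Bisection G) where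
  star_involutive a := by
    refine C0Bisection.ext (funext fun g => ?_)
    rw [star_apply, star_apply, star_star_arrow, Complex.conj_conj]
  star_mul a b := by
    refine ext_of_dom ?_ ?_
    · intro k hk
      rw [dom_star, dom_mul] at hk
      obtain ⟨x, ⟨g, hg, h, hh, e⟩, rfl⟩ := hk
      rw [star_apply, star_star_arrow, mul_apply a b hg hh e,
        mul_apply (star b) (star a) (by rw [dom_star]; exact ⟨h, hh, rfl⟩)
          (by rw [dom_star]; exact ⟨g, hg, rfl⟩) (star_mul_some e),
        star_apply, star_apply, star_star_arrow, star_star_arrow, map_mul, mul_comm]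
    · intro k hk
      rw [dom_mul, dom_star, dom_star] at hk
      obtain ⟨-, ⟨h, hh, rfl⟩, -, ⟨g, hg, rfl⟩, e⟩ := hk
      have e' := star_mul_some e
      rw [star_star_arrow, star_star_arrow] at e'
      rw [star_apply, mul_apply a b hg hh e',
        mul_apply (star b) (star a) (by rw [dom_star]; exact ⟨h, hh, rfl⟩)
          (by rw [dom_star]; exact ⟨g, hg, rfl⟩) e,
        star_apply, star_apply, star_star_arrow, star_star_arrow, map_mul, mul_comm]

end C0Bisection

section Ultrafilters

variable {G : Type*} [TopologicalSpace G] [ArrowGroupoid G]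

/-- The up-closure `T^≾ = {a : t ≾ a for some t ∈ T}` with respect to `*`-domination. -/
def upClosure (T : Set (C0Bisection G)) : Set (C0Bisection G) := {a | ∃ t ∈ T, t.StarDom a}

/-- Filters for `*`-domination: non-empty sets `U` such that
`a, b ∈ U ↔ ∃ c ∈ U, c ≾ a, b`. -/
def IsStarFilter (U : Set (C0Bisection G)) : Prop :=
  U.Nonempty ∧ ∀ a b, (a ∈ U ∧ b ∈ U) ↔ ∃ c ∈ U, c.StarDom a ∧ c.StarDom b

/-- Ultrafilters: maximal proper filters. -/
def IsStarUltrafilter (U : Set (C0Bisection G)) : Prop :=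
  Maximal (fun F => IsStarFilter F ∧ F ≠ Set.univ) U

/-- The space `𝒰(S)` of ultrafilters. -/
def UltraSpace (G : Type*) [TopologicalSpace G] [ArrowGroupoid G] : Type _ :=
  {U : Set (C0Bisection G) // IsStarUltrafilter U}

/-- The topology on `𝒰(S)` generated by the sets `𝒰_a = {U : a ∈ U}`. -/
instance : TopologicalSpace (UltraSpace G) :=
  TopologicalSpace.generateFrom (Set.range fun a : C0Bisection G => {U : UltraSpace G | a ∈ U.1})

/-- `S_g = {a ∈ S : g ∈ int(a⁻¹[𝕋])}`. -/
def germSet (g : G) : Set (C0Bisection G) := {a | g ∈ interior a.preCircle}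

end Ultrafilters

end Weyl

open Weyl ArrowGroupoid

open Weyl ArrowGroupoid

namespace Weyl

/-! ### Open bisections: Hausdorffness and bump functions -/

section Bisections

variable {G : Type*} [TopologicalSpace G] [ArrowGroupoid G]

/-! Although `G` need not be Hausdorff, it is so locally: on a bisection the range map is continuous
and injective into the Hausdorff unit space (`IsBisection.t2Space`). Continuity of the product and
openness of the unit space provide an open bisection around every arrow, and local compactness then
gives bump functions there (`exists_mem_germSet_dom_subset`). These are the elements of `S` that
separate arrows and detect the topology.

Each `S_g` is a proper filter, and bump functions avoiding a compact set show that it is maximal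
(`isStarUltrafilter_germSet`). Conversely, for a proper filter `U` the sets `c⁻¹[𝕋]`, with `c` in
`U` dominated by a fixed `a ∈ U`, are a directed family of non-empty compact subsets of the
Hausdorff space `dom(a)`. A common point `g` satisfies `U ⊆ S_g`
(`IsStarFilter.exists_subset_germSet`), with equality if `U` is an ultrafilter.

On the algebraic side, `germSet_star` and `germSet_mul` identify the operations on the sets `S_g`
with those of `G`. The groupoid axioms on `𝒰(S)` are therefore transported along the bijection, and
only the formulas for the transported operations remain to be checked. -/

omit [TopologicalSpace G] in
theorem IsBisection.mono {O N : Set G} (hN : IsBisection N) (h : O ⊆ N) : IsBisection O := by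
  refine Set.union_subset ?_ ?_
  · rintro u ⟨g, hg, _, ⟨k, hk, rfl⟩, e⟩
    exact hN (Or.inl ⟨g, h hg, _, ⟨k, h hk, rfl⟩, e⟩)
  · rintro u ⟨_, ⟨k, hk, rfl⟩, g, hg, e⟩
    exact hN (Or.inr ⟨_, ⟨k, h hk, rfl⟩, g, h hg, e⟩)

variable [EtaleGroupoid G]

/-- Continuity of the partial product in terms of open subsets of `G`: an open set of composable
pairs is the trace of an open set of `G × G`, which contains an open box around `(g, h)`. -/
theorem exists_open_setMul_subset {g h k : G} (e : pmul g h = some k) {N : Set G}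
    (hN : IsOpen N) (hk : k ∈ N) :
    ∃ A B : Set G, IsOpen A ∧ IsOpen B ∧ g ∈ A ∧ h ∈ B ∧ setMul A B ⊆ N := by
  obtain ⟨W, hW, hWe⟩ := isOpen_induced_iff.1
    (hN.preimage (EtaleGroupoid.continuous_mul (G := G)))
  have hmem : ∀ {x y z : G}, pmul x y = some z → ((x, y) ∈ W ↔ z ∈ N) := by
    intro x y z hz
    have := Set.ext_iff.1 hWe ⟨(x, y), by simp [hz]⟩
    simpa [mulMap, hz] using this
  obtain ⟨A, B, hA, hB, hgA, hhB, hAB⟩ := isOpen_prod_iff.1 hW g h ((hmem e).2 hk)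
  refine ⟨A, B, hA, hB, hgA, hhB, ?_⟩
  rintro z ⟨x, hx, y, hy, hz⟩
  exact (hmem hz).1 (hAB ⟨hx, hy⟩)

/-- Both `gg⋆` and `g⋆g` lie in the open unit space, so by continuity products of arrows near `g`
with adjoints of arrows near `g`, in either order, are units. -/
theorem exists_isOpen_isBisection (g : G) : ∃ O : Set G, IsOpen O ∧ IsBisection O ∧ g ∈ O := by
  obtain ⟨A, B, hA, hB, hgA, hgB, hAB⟩ := exists_open_setMul_subset (mul_star_arrow g)
    EtaleGroupoid.isOpen_units (rng_mem g)
  obtain ⟨C, D, hC, hD, hgC, hgD, hCD⟩ := exists_open_setMul_subset (star_mul_arrow g)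
    EtaleGroupoid.isOpen_units (src_mem g)
  refine ⟨(A ∩ star ⁻¹' B) ∩ (star ⁻¹' C ∩ D),
    (hA.inter (hB.preimage EtaleGroupoid.continuous_star)).inter
      ((hC.preimage EtaleGroupoid.continuous_star).inter hD), ?_, ⟨hgA, hgB⟩, hgC, hgD⟩
  refine Set.union_subset ?_ ?_
  · rintro u ⟨x, hx, _, ⟨y, hy, rfl⟩, e⟩
    exact hAB ⟨x, hx.1.1, _, hy.1.2, e⟩
  · rintro u ⟨_, ⟨y, hy, rfl⟩, x, hx, e⟩
    exact hCD ⟨_, hy.2.1, x, hx.2.2, e⟩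

/-- The range map embeds a bisection continuously and injectively in the Hausdorff unit space. -/
theorem IsBisection.t2Space [T2Space (units G)] {O : Set G} (hO : IsBisection O) :
    T2Space O := by
  refine T2Space.of_injective_continuous (f := fun x : O => (⟨rng x.1, rng_mem _⟩ : units G)) ?_
    ((C0Bisection.continuous_rng.comp continuous_subtype_val).subtype_mk _)
  intro x y h
  exact Subtype.ext (hO.eq_of_rng x.2 y.2 (congrArg Subtype.val h))

variable [T2Space (units G)]

/-- A compact `K` may fail to be closed in `G`, but it is closed in the Hausdorff space `O`, and `O`
is open in `G`. -/
theorem IsBisection.isOpen_diff_of_isCompact {O K : Set G} (hO : IsBisection O)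
    (hOo : IsOpen O) (hK : IsCompact K) (hKO : K ⊆ O) : IsOpen (O \ K) := by
  have := hO.t2Space
  have hc : IsClosed (Subtype.val ⁻¹' K : Set O) :=
    (Topology.IsInducing.subtypeVal.isCompact_preimage_iff (by simpa using hKO)).2 hK |>.isClosed
  have := hOo.isOpenMap_subtype_val _ hc.isOpen_compl
  rwa [← Set.preimage_compl, Subtype.image_preimage_coe] at this

variable [LocallyCompactSpace G]

/-- Urysohn's lemma on an open bisection. -/
theorem exists_mem_germSet_dom_subset {O : Set G} (hOo : IsOpen O) (hO : IsBisection O) {g : G}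
    (hg : g ∈ O) : ∃ a ∈ germSet g, a.dom ⊆ O := by
  have := hO.t2Space
  have : LocallyCompactSpace O := hOo.locallyCompactSpace
  obtain ⟨s, hs, hgs⟩ := exists_compact_mem_nhds (⟨g, hg⟩ : O)
  -- With the empty set as closed set, Urysohn's lemma yields a compactly supported `f` equal to `1`
  -- on the neighbourhood `s` of `g`.
  obtain ⟨f, hf1, -, hfc, hf01⟩ := exists_continuous_one_zero_of_isCompact hs isClosed_empty
    (Set.disjoint_empty s)
  -- Extension by zero may be discontinuous on `G`, since the compact support of `f` need not be
  -- closed there; only continuity on the support is needed.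
  let F : G → ℂ := Function.extend (Subtype.val : O → G) (fun x => (f x : ℂ)) 0
  have hF : ∀ x : O, F x = f x := fun x => Subtype.val_injective.extend_apply _ _ x
  have hF0 : ∀ x, x ∉ O → F x = 0 := fun x hx =>
    Function.extend_apply' _ _ _ (by rintro ⟨y, rfl⟩; exact hx y.2)
  have hsub : Function.support F ⊆ O := fun x hx => by
    by_contra h
    exact hx (hF0 x h)
  have hFc : ContinuousOn F O := by
    rw [continuousOn_iff_continuous_domRestrict]
    have : O.domRestrict F = fun x => (f x : ℂ) := funext hF
    rw [this]
    exact Complex.continuous_ofReal.comp f.continuous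
  let a : C0Bisection G :=
    { toFun := F
      isOpen_dom := by
        have := hFc.isOpen_inter_preimage hOo (isOpen_compl_singleton (x := (0 : ℂ)))
        convert this using 1
        ext x
        exact ⟨fun hx => ⟨hsub hx, hx⟩, fun hx => hx.2⟩
      isBisection_dom := hO.mono hsub
      continuousOn_dom := hFc.mono hsub
      norm_le_one := fun x => by
        by_cases hx : x ∈ O
        · rw [show F x = _ from hF ⟨x, hx⟩, Complex.norm_real, Real.norm_eq_abs, abs_le]
          have := hf01 ⟨x, hx⟩
          exact ⟨by linarith [this.1], this.2⟩
        · rw [hF0 x hx, norm_zero]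
          exact zero_le_one
      vanishes := fun V hV h0 => by
        have hcl : IsClosed {x : O | (f x : ℂ) ∉ V} :=
          hV.isClosed_compl.preimage (Complex.continuous_ofReal.comp f.continuous)
        -- As `0 ∈ V`, this closed set lies in the compact support of `f`.
        have hcp : IsCompact {x : O | (f x : ℂ) ∉ V} :=
          hfc.isCompact.of_isClosed_subset hcl fun x hx =>
            subset_tsupport _ fun h => hx (by rw [h]; simpa using h0)
        convert hcp.image continuous_subtype_val using 1
        ext x
        constructor
        · rintro ⟨hx, hxV⟩
          exact ⟨⟨x, hsub hx⟩, by rwa [Set.mem_preimage, hF ⟨x, hsub hx⟩] at hxV, rfl⟩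
        · rintro ⟨y, hy, rfl⟩
          have hyV : F y ∉ V := by rw [hF]; exact hy
          exact ⟨fun h => hyV (by rw [h]; exact h0), hyV⟩ }
  refine ⟨a, ?_, hsub⟩
  refine mem_interior_iff_mem_nhds.2 (Filter.mem_of_superset
    (hOo.isOpenMap_subtype_val.image_mem_nhds hgs) ?_)
  rintro _ ⟨x, hx, rfl⟩
  have h1 : F x = 1 := by rw [hF, hf1 hx]; simp
  exact ⟨show F x ≠ 0 by rw [h1]; exact one_ne_zero, show ‖F x‖ = 1 by rw [h1, norm_one]⟩

end Bisections

/-! ### Filters and the sets `S_g` -/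

section Filters

variable {G : Type*} [TopologicalSpace G] [ArrowGroupoid G]

theorem C0Bisection.preCircle_subset_dom (a : C0Bisection G) : a.preCircle ⊆ a.dom :=
  fun _ h => h.1

/-- Values have modulus at most one, so `a⁻¹[𝕋]` is what remains of `dom(a)` after removing the
preimage of the open unit ball. -/
theorem C0Bisection.isCompact_preCircle (a : C0Bisection G) : IsCompact a.preCircle := by
  convert a.vanishes (Metric.ball 0 1) Metric.isOpen_ball (Metric.mem_ball_self one_pos) using 1
  ext g
  refine and_congr_right fun _ => ?_
  rw [Set.mem_preimage, mem_ball_zero_iff, not_lt]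
  exact ⟨fun h => h.ge, fun h => le_antisymm (a.norm_le_one g) h⟩

theorem C0Bisection.StarDom.dom_subset {a b : C0Bisection G} (h : a.StarDom b) :
    a.dom ⊆ b.dom := h.trans b.preCircle_subset_dom

theorem mem_dom_of_mem_germSet {a : C0Bisection G} {g : G} (h : a ∈ germSet g) : g ∈ a.dom :=
  (interior_subset h).1

theorem mem_germSet_of_starDom {a b : C0Bisection G} {g : G} (h : a.StarDom b)
    (hg : g ∈ a.dom) : b ∈ germSet g :=
  mem_interior.2 ⟨a.dom, h, a.isOpen_dom, hg⟩

theorem IsStarFilter.mem_of_starDom {U : Set (C0Bisection G)} (hU : IsStarFilter U)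
    {a b : C0Bisection G} (ha : a ∈ U) (h : a.StarDom b) : b ∈ U :=
  ((hU.2 b b).2 ⟨a, ha, h, h⟩).1

theorem IsStarFilter.exists_starDom {U : Set (C0Bisection G)} (hU : IsStarFilter U)
    {a b : C0Bisection G} (ha : a ∈ U) (hb : b ∈ U) :
    ∃ c ∈ U, c.StarDom a ∧ c.StarDom b := (hU.2 a b).1 ⟨ha, hb⟩

/-- An element with empty domain is dominated by everything, so a filter containing it is all of
`S`. -/
theorem IsStarFilter.dom_nonempty {U : Set (C0Bisection G)} (hU : IsStarFilter U)
    (hp : U ≠ Set.univ) {a : C0Bisection G} (ha : a ∈ U) : a.dom.Nonempty := by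
  by_contra h
  rw [Set.not_nonempty_iff_eq_empty] at h
  refine hp (Set.eq_univ_of_forall fun b => hU.mem_of_starDom ha ?_)
  rw [C0Bisection.StarDom, h]
  exact Set.empty_subset _

variable [EtaleGroupoid G] [T2Space (units G)] [LocallyCompactSpace G]

theorem isStarFilter_germSet (g : G) : IsStarFilter (germSet g) := by
  refine ⟨?_, fun a b => ⟨?_, ?_⟩⟩
  · obtain ⟨O, hOo, hO, hg⟩ := exists_isOpen_isBisection g
    obtain ⟨a, ha, -⟩ := exists_mem_germSet_dom_subset hOo hO hg
    exact ⟨a, ha⟩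
  · rintro ⟨ha, hb⟩
    obtain ⟨c, hc, hcd⟩ := exists_mem_germSet_dom_subset
      (isOpen_interior.inter isOpen_interior)
      (a.isBisection_dom.mono fun x hx => (interior_subset hx.1).1) (g := g) ⟨ha, hb⟩
    exact ⟨c, hc, fun x hx => interior_subset (hcd hx).1,
      fun x hx => interior_subset (hcd hx).2⟩
  · rintro ⟨c, hc, ha, hb⟩
    exact ⟨mem_germSet_of_starDom ha (mem_dom_of_mem_germSet hc),
      mem_germSet_of_starDom hb (mem_dom_of_mem_germSet hc)⟩

theorem isStarUltrafilter_germSet (g : G) : IsStarUltrafilter (germSet g) := by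
  refine ⟨⟨isStarFilter_germSet g, fun h => ?_⟩, ?_⟩
  · let z : C0Bisection G :=
      { toFun := 0
        isOpen_dom := by simp
        isBisection_dom := by
          rw [Function.support_zero]
          rintro u (⟨_, h, _⟩ | ⟨_, ⟨_, h, _⟩, _⟩) <;> exact h.elim
        continuousOn_dom := continuousOn_const
        norm_le_one := by simp
        vanishes := by simp }
    have hz : z ∈ germSet g := h ▸ Set.mem_univ z
    exact mem_dom_of_mem_germSet hz rfl
  · rintro F ⟨hF, hp⟩ hgF a ha
    obtain ⟨b, hb⟩ := (isStarFilter_germSet g).1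
    obtain ⟨c, hc, hca, hcb⟩ := hF.exists_starDom ha (hgF hb)
    refine mem_germSet_of_starDom hca (c.preCircle_subset_dom ?_)
    -- If `g ∉ c⁻¹[𝕋]`, a bump `e ∈ S_g ⊆ F` lives off this compact set, whereas some `d ∈ F` has
    -- its domain inside it. A common lower bound of `d` and `e` in `F` would have empty domain.
    by_contra hg
    obtain ⟨d, hd, hdc, -⟩ := hF.exists_starDom hc hc
    obtain ⟨e, he, hed⟩ := exists_mem_germSet_dom_subset
      (b.isBisection_dom.isOpen_diff_of_isCompact b.isOpen_dom c.isCompact_preCircle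
        (c.preCircle_subset_dom.trans hcb.dom_subset))
      (b.isBisection_dom.mono Set.sdiff_subset) ⟨mem_dom_of_mem_germSet hb, hg⟩
    obtain ⟨f, hf, hfd, hfe⟩ := hF.exists_starDom hd (hgF he)
    obtain ⟨x, hx⟩ := hF.dom_nonempty hp hf
    exact (hed (hfe.dom_subset hx)).2 (hdc (hfd.dom_subset hx))

omit [LocallyCompactSpace G] in
-- A compactness argument; restricting to elements below one `a ∈ U` places all the compact sets in
-- the Hausdorff space `dom(a)`, where they are closed.
theorem IsStarFilter.exists_subset_germSet {U : Set (C0Bisection G)} (hU : IsStarFilter U)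
    (hp : U ≠ Set.univ) : ∃ g, U ⊆ germSet g := by
  obtain ⟨a, ha⟩ := hU.1
  have := a.isBisection_dom.t2Space
  let ι := {c : C0Bisection G // c ∈ U ∧ c.StarDom a}
  obtain ⟨b, hb, hba, -⟩ := hU.exists_starDom ha ha
  have : Nonempty ι := ⟨⟨b, hb, hba⟩⟩
  let K : ι → Set (Function.support a) := fun c => Subtype.val ⁻¹' c.1.preCircle
  have hK : ∀ c, IsCompact (K c) := fun c =>
    (Topology.IsInducing.subtypeVal.isCompact_preimage_iff (by
      rw [Subtype.range_coe]
      exact c.1.preCircle_subset_dom.trans c.2.2.dom_subset)).2 c.1.isCompact_preCircle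
  have hdir : Directed (· ⊇ ·) K := by
    intro c d
    obtain ⟨e, he, hec, hed⟩ := hU.exists_starDom c.2.1 d.2.1
    exact ⟨⟨e, he, hec.dom_subset.trans c.2.2⟩,
      fun x hx => hec (e.preCircle_subset_dom hx), fun x hx => hed (e.preCircle_subset_dom hx)⟩
  have hne : ∀ c, (K c).Nonempty := by
    intro c
    obtain ⟨d, hd, hdc, -⟩ := hU.exists_starDom c.2.1 c.2.1
    obtain ⟨x, hx⟩ := hU.dom_nonempty hp hd
    exact ⟨⟨x, c.2.2.dom_subset (hdc.dom_subset hx)⟩, hdc hx⟩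
  obtain ⟨g, hg⟩ := IsCompact.nonempty_iInter_of_directed_nonempty_isCompact_isClosed K hdir hne
    hK fun c => (hK c).isClosed
  refine ⟨g, fun c hc => ?_⟩
  -- The common point lies in `d⁻¹[𝕋] ⊆ dom(d)`, and `dom(d)` is an open subset of `c⁻¹[𝕋]`.
  obtain ⟨d, hd, hdc, hda⟩ := hU.exists_starDom hc ha
  exact mem_germSet_of_starDom hdc
    (d.preCircle_subset_dom (Set.mem_iInter.1 hg ⟨d, hd, hda⟩))

theorem germSet_injective : Function.Injective (germSet : G → Set (C0Bisection G)) := by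
  intro g h e
  obtain ⟨b, hb⟩ := (isStarFilter_germSet g).1
  have hh : h ∈ b.dom := mem_dom_of_mem_germSet (e ▸ hb)
  by_contra hne
  -- Both points lie in `dom(b)`, so a bump at `g` supported in `dom(b) ∖ {h}` separates them.
  obtain ⟨c, hc, hcd⟩ := exists_mem_germSet_dom_subset
    (b.isBisection_dom.isOpen_diff_of_isCompact b.isOpen_dom isCompact_singleton
      (Set.singleton_subset_iff.2 hh))
    (b.isBisection_dom.mono Set.sdiff_subset) ⟨mem_dom_of_mem_germSet hb, hne⟩
  exact (hcd (mem_dom_of_mem_germSet (e ▸ hc))).2 rfl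

/-- The homeomorphism `g ↦ S_g` from `G` onto the ultrafilter space. -/
noncomputable def germHomeomorph (G : Type*) [TopologicalSpace G] [ArrowGroupoid G]
    [EtaleGroupoid G] [LocallyCompactSpace G] [T2Space (units G)] : G ≃ₜ UltraSpace G :=
  Equiv.toHomeomorphOfContinuousOpen
    (Equiv.ofBijective (fun g => ⟨germSet g, isStarUltrafilter_germSet g⟩)
      ⟨fun _ _ e => germSet_injective (congrArg Subtype.val e), fun U => by
        obtain ⟨g, hg⟩ := U.2.prop.1.exists_subset_germSet U.2.prop.2
        exact ⟨g, Subtype.ext (U.2.eq_of_subset (isStarUltrafilter_germSet g).prop hg).symm⟩⟩)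
    -- The preimage of the subbasic set `𝒰_a` is the interior of `a⁻¹[𝕋]`.
    (continuous_generateFrom_iff.2 (by
      rintro _ ⟨a, rfl⟩
      exact isOpen_interior (s := a.preCircle)))
    (by
      intro O hO
      refine isOpen_iff_mem_nhds.2 ?_
      rintro _ ⟨g, hg, rfl⟩
      obtain ⟨N, hNo, hN, hgN⟩ := exists_isOpen_isBisection g
      -- For a bump `a` at `g` supported in `O`, every ultrafilter in `𝒰_a` is some `S_h` with `h ∈
      -- dom(a) ⊆ O`.
      obtain ⟨a, ha, had⟩ := exists_mem_germSet_dom_subset (hO.inter hNo)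
        (hN.mono Set.inter_subset_right) ⟨hg, hgN⟩
      refine mem_nhds_iff.2 ⟨{U : UltraSpace G | a ∈ U.1}, ?_,
        TopologicalSpace.isOpen_generateFrom_of_mem ⟨a, rfl⟩, ha⟩
      intro U hU
      obtain ⟨h, hh⟩ := U.2.prop.1.exists_subset_germSet U.2.prop.2
      have e := U.2.eq_of_subset (isStarUltrafilter_germSet h).prop hh
      exact ⟨h, (had (mem_dom_of_mem_germSet (hh hU))).1, Subtype.ext e.symm⟩)

/-! ### Compatibility with the groupoid operations -/

omit [T2Space (units G)] [LocallyCompactSpace G] in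
theorem star_mem_germSet {a : C0Bisection G} {g : G} (ha : a ∈ germSet g) :
    star a ∈ germSet (star g) := by
  refine mem_interior.2 ⟨star ⁻¹' interior a.preCircle, ?_,
    isOpen_interior.preimage EtaleGroupoid.continuous_star, ?_⟩
  · intro x hx
    obtain ⟨h1, h2⟩ := interior_subset hx
    refine ⟨?_, ?_⟩
    · rw [C0Bisection.dom_star, star_image_eq]
      exact h1
    · rw [C0Bisection.star_apply, Complex.norm_conj]
      exact h2
  · rwa [Set.mem_preimage, star_star_arrow]

omit [LocallyCompactSpace G] in
theorem germSet_star (g : G) : germSet (star g) = star '' germSet g := by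
  ext a
  constructor
  · intro ha
    refine ⟨star a, ?_, star_star a⟩
    simpa [star_star_arrow] using star_mem_germSet ha
  · rintro ⟨b, hb, rfl⟩
    exact star_mem_germSet hb

/-- By continuity of the product, bumps `b`, `c` with small domains around `g`, `h` have
`dom(b)dom(c)` inside `a⁻¹[𝕋]`. Conversely, `k = gh` lies in the open set `dom(bc)` whenever `b ∈
S_g` and `c ∈ S_h`. -/
theorem germSet_mul {g h k : G} (e : pmul g h = some k) :
    germSet k = upClosure (germSet g * germSet h) := by
  ext a
  constructor
  · intro ha
    obtain ⟨A, B, hA, hB, hgA, hhB, hAB⟩ := exists_open_setMul_subset e isOpen_interior ha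
    obtain ⟨O, hOo, hO, hgO⟩ := exists_isOpen_isBisection g
    obtain ⟨N, hNo, hN, hhN⟩ := exists_isOpen_isBisection h
    obtain ⟨b, hb, hbd⟩ := exists_mem_germSet_dom_subset (hA.inter hOo)
      (hO.mono Set.inter_subset_right) ⟨hgA, hgO⟩
    obtain ⟨c, hc, hcd⟩ := exists_mem_germSet_dom_subset (hB.inter hNo)
      (hN.mono Set.inter_subset_right) ⟨hhB, hhN⟩
    refine ⟨b * c, Set.mul_mem_mul hb hc, fun x hx => ?_⟩
    rw [C0Bisection.dom_mul] at hx
    obtain ⟨y, hy, z, hz, hyz⟩ := hx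
    exact interior_subset (hAB ⟨y, (hbd hy).1, z, (hcd hz).1, hyz⟩)
  · rintro ⟨_, ⟨b, hb, c, hc, rfl⟩, hd⟩
    refine mem_germSet_of_starDom hd ?_
    rw [C0Bisection.dom_mul]
    exact ⟨g, mem_dom_of_mem_germSet hb, h, mem_dom_of_mem_germSet hc, e⟩

end Filters

/-- Transport of a groupoid structure along a bijection. -/
abbrev ArrowGroupoid.transport {G H : Type*} [ArrowGroupoid G] (φ : G ≃ H) : ArrowGroupoid H where
  star a := φ (star (φ.symm a))
  pmul a b := (pmul (φ.symm a) (φ.symm b)).map φ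
  star_star_arrow a := by simp [star_star_arrow]
  pmul_assoc a b c := by
    have h := congrArg (Option.map φ) (pmul_assoc (φ.symm a) (φ.symm b) (φ.symm c))
    simpa [Option.map_bind, Option.bind_map, Function.comp_def] using h
  star_pmul a b := by
    have h := congrArg (Option.map φ) (star_pmul (φ.symm a) (φ.symm b))
    simpa [Function.comp_def] using h
  pmul_star_isSome a := by simpa using pmul_star_isSome (φ.symm a)
  exists_range b := by
    obtain ⟨r, hr, hD⟩ := exists_range (φ.symm b)
    refine ⟨φ r, fun a x hx => ?_, fun a => by simpa using hD (φ.symm a)⟩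
    obtain ⟨y, hy, rfl⟩ := Option.map_eq_some_iff.1 hx
    rw [Equiv.symm_apply_apply] at hy
    rw [hr _ _ hy, Equiv.apply_symm_apply]
  unitary_left a u h b x hx := by
    obtain ⟨v, hv, rfl⟩ := Option.map_eq_some_iff.1 h
    obtain ⟨y, hy, rfl⟩ := Option.map_eq_some_iff.1 hx
    rw [Equiv.symm_apply_apply] at hv hy
    rw [unitary_left _ _ hv _ _ hy, Equiv.apply_symm_apply]
  unitary_right a u h b x hx := by
    obtain ⟨v, hv, rfl⟩ := Option.map_eq_some_iff.1 h
    obtain ⟨y, hy, rfl⟩ := Option.map_eq_some_iff.1 hx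
    rw [Equiv.symm_apply_apply] at hv hy
    rw [unitary_right _ _ hv _ _ hy, Equiv.apply_symm_apply]

end Weyl

/-! ### The groupoid of ultrafilters -/

theorem proposition1p2 (G : Type*) [TopologicalSpace G] [ArrowGroupoid G] [EtaleGroupoid G]
    [LocallyCompactSpace G] [T2Space (units G)] :
    ∃ (Φ : G ≃ₜ UltraSpace G) (W : ArrowGroupoid (UltraSpace G)),
      -- `Φ` is the map `g ↦ S_g`
      (∀ g : G, (Φ g).1 = germSet g) ∧
      -- the groupoid structure of `𝒰(S)`: `U ↦ U⋆`, and `(U, V) ↦ (UV)^≾`, defined whenever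
      -- `(U⋆U)^≾ = (VV⋆)^≾`
      (∀ U : UltraSpace G, (W.star U).1 = star '' U.1) ∧
      (∀ U V : UltraSpace G, (W.pmul U V).isSome ↔
        upClosure ((star '' U.1) * U.1) = upClosure (V.1 * (star '' V.1))) ∧
      (∀ U V X : UltraSpace G, W.pmul U V = some X → X.1 = upClosure (U.1 * V.1)) ∧
      -- `Φ` is an isomorphism of groupoids
      (∀ g : G, germSet (star g) = star '' germSet g) ∧
      (∀ g h : G, (pmul g h).isSome ↔ (W.pmul (Φ g) (Φ h)).isSome) ∧
      (∀ g h k : G, pmul g h = some k → germSet k = upClosure (germSet g * germSet h)) := by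
  have hΦ : ∀ g : G, (germHomeomorph G g).1 = germSet g := fun _ => rfl
  have hpmul : ∀ g h : G, (ArrowGroupoid.transport (germHomeomorph G).toEquiv).pmul
      (germHomeomorph G g) (germHomeomorph G h) = (pmul g h).map (germHomeomorph G) := by
    intro g h
    change (pmul ((germHomeomorph G).symm (germHomeomorph G g))
      ((germHomeomorph G).symm (germHomeomorph G h))).map (germHomeomorph G) = _
    rw [Homeomorph.symm_apply_apply, Homeomorph.symm_apply_apply]
  refine ⟨germHomeomorph G, ArrowGroupoid.transport (germHomeomorph G).toEquiv, hΦ, ?_, ?_, ?_,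
    germSet_star, ?_, fun g h k => germSet_mul⟩
  · intro U
    obtain ⟨g, rfl⟩ := (germHomeomorph G).surjective U
    change germSet (star ((germHomeomorph G).symm (germHomeomorph G g))) = _
    rw [Homeomorph.symm_apply_apply, germSet_star, hΦ]
  · intro U V
    obtain ⟨g, rfl⟩ := (germHomeomorph G).surjective U
    obtain ⟨h, rfl⟩ := (germHomeomorph G).surjective V
    -- The two up-closures are `S_u` and `S_v` for the units `u = g⋆g` and `v = hh⋆`. By injectivity
    -- they agree exactly when `u = v`, which is composability of `g` and `h`.
    rw [hpmul, hΦ, hΦ, ← germSet_star, ← germSet_star, ← germSet_mul (star_mul_arrow g),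
      ← germSet_mul (mul_star_arrow h), germSet_injective.eq_iff, Option.isSome_map]
    constructor
    · intro hd
      obtain ⟨x, hx⟩ := Option.isSome_iff_exists.1 hd
      exact src_eq_rng hx
    · exact fun e => Option.isSome_iff_exists.2 (exists_mul e)
  · intro U V X hX
    obtain ⟨g, rfl⟩ := (germHomeomorph G).surjective U
    obtain ⟨h, rfl⟩ := (germHomeomorph G).surjective V
    rw [hpmul] at hX
    obtain ⟨k, hk, rfl⟩ := Option.map_eq_some_iff.1 hX
    exact germSet_mul hk
  · intro g h
    rw [hpmul, Option.isSome_map]
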